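/- **Model.** Let $G$ be a simple graph on the vertices $1,\dots,n$ with $m$ edges. Each edge is held by exactly one of $m$ stations, whose identifiers are $1,\dots,m$ (the stations do not know $m$). In each synchronous step some stations broadcast on a multiple-access channel with collision detection: if exactly one station broadcasts, all stations hear its message; if none does, all hear silence; if at least two do, all hear noise (a collision). A *spanning forest* of $G$ is always a maximal one: a set $T$ of edges of $G$ containing no cycle such that adding any other edge of $G$ to $T$ creates a cycle; $|T|$ is its number of edges. **Algorithm RandSimple.** All edges are initially *waiting*, and every station keeps a number $a:=1$, a counter $:=0$, and the set of *revealed* edges, initially empty. Whenever an edge is heard on the channel: if it is waiting, it becomes revealed; then every other waiting edge that makes a cycle together with revealed edges becomes a *cycle* edge. The stations repeat the following round of three steps: - Step A: each station holding a waiting edge broadcasts it with probability $1/a$, all these random trials (over steps and stations) being independent. If noise is heard, then $a:=3a$; if silence is heard, then $a:=\max\{a/3,1\}$. The counter is then increased by $1$. - Step C: the station whose identifier equals the counter (if any) broadcasts its edge, whatever the status of the edge. - Step D: each station holding a waiting edge broadcasts a dummy message. If silence is heard in this step, all stations terminate, and the set of revealed edges is the output. The running time is the number of steps until all stations have terminated.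 **Theorem.** There is an absolute constant $C$ such that for every such input the following hold. 1. For all outcomes of the random trials, RandSimple terminates within $C\,m$ steps. Its output, known to every station, is a spanning forest $T$ of $G$; each edge of $T$ was heard on the channel at some step; and the edges whose status at their own station is revealed are exactly those of $T$. 2. The running time is a random variable, and for every spanning forest $T$ of $G$ (in particular, for the one that is found) its expectation $\mathbb{E}$ satisfies $|T|\le \mathbb{E}\le C\,|T|$. -/

import Mathlib

open MeasureTheory ProbabilityTheory
open scoped ENNReal

/-! ### Multiple-access channel with collision detection -/

/-- What all the stations hear on the channel in one step. -/
inductive Feedback (Msg : Type) : Type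
  | silence : Feedback Msg
  | heard (x : Msg) : Feedback Msg
  | noise : Feedback Msg

open Classical in
/-- The channel: `b p` says that station `p` broadcasts, and `msg p` is the message it sends.
The message is delivered iff exactly one station broadcasts; several broadcasts are heard as
noise (a collision). -/
noncomputable def channel {ι Msg : Type} (b : ι → Prop) (msg : ι → Msg) : Feedback Msg :=
  if h : ∃! p, b p then .heard (msg h.choose)
  else if ∃ p, b p then .noise
  else .silence

/-- The code of a station in a synchronous randomized algorithm. `Inp` is the input of a station,
`St` its local memory. In a step, a station with input `i` and memory `s` broadcasts the message
`msg i s` with probability `prob i s` (`0`: it stays silent, `1`: it surely broadcasts), hears the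
feedback `f` of the channel, and changes its memory to `next i s f`. -/
structure Protocol (Inp St Msg : Type) where
  init : St
  prob : Inp → St → ℝ
  msg : Inp → St → Msg
  next : Inp → St → Feedback Msg → St
  halted : St → Prop

namespace Protocol

variable {ι Inp St Msg : Type}

/-- Station `p` broadcasts if it has not halted and its random trial succeeds. The trial is decided
by a number `x p` in `[0,1)`: it is a success iff `x p` is less than the prescribed probability. -/
def Broadcasts (A : Protocol Inp St Msg) (inp : ι → Inp) (x : ι → ℝ) (s : ι → St) (p : ι) : Prop :=
  ¬ A.halted (s p) ∧ x p < A.prob (inp p) (s p)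

/-- The feedback heard in a step. -/
noncomputable def feedback (A : Protocol Inp St Msg) (inp : ι → Inp) (x : ι → ℝ) (s : ι → St) :
    Feedback Msg :=
  channel (A.Broadcasts inp x s) (fun p => A.msg (inp p) (s p))

open Classical in
/-- The memories of the stations after a step. -/
noncomputable def step (A : Protocol Inp St Msg) (inp : ι → Inp) (x : ι → ℝ) (s : ι → St) :
    ι → St :=
  fun p => if A.halted (s p) then s p else A.next (inp p) (s p) (A.feedback inp x s)

/-- The memories of the stations after `t` steps; `u t p` decides the trial of station `p` in the
step with index `t`. -/
noncomputable def run (A : Protocol Inp St Msg) (inp : ι → Inp) (u : ℕ → ι → ℝ) : ℕ → ι → St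
  | 0 => fun _ => A.init
  | t + 1 => A.step inp (u t) (A.run inp u t)

/-- The feedback heard in the step with index `t` of the execution. -/
noncomputable def feedbackAt (A : Protocol Inp St Msg) (inp : ι → Inp) (u : ℕ → ι → ℝ) (t : ℕ) :
    Feedback Msg :=
  A.feedback inp (u t) (A.run inp u t)

/-- The running time: the number of steps until all the stations have halted (`⊤` if never). -/
noncomputable def time (A : Protocol Inp St Msg) (inp : ι → Inp) (u : ℕ → ι → ℝ) : ℕ∞ :=
  ⨅ (k : ℕ) (_ : ∀ p, A.halted (A.run inp u k p)), (k : ℕ∞)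

end Protocol

/-! ### Spanning forests -/

/-- The edges in `R` make a forest. -/
def IsForest {V : Type} (R : Finset (Sym2 V)) : Prop :=
  (SimpleGraph.fromEdgeSet (R : Set (Sym2 V))).IsAcyclic

/-- `T` is (the edge set of) a maximal spanning forest of `G`: a forest of edges of `G` such that
adding a new edge of `G` always creates a cycle. -/
def IsSpanningForest {V : Type} [DecidableEq V] (G : SimpleGraph V) (T : Finset (Sym2 V)) : Prop :=
  (T : Set (Sym2 V)) ⊆ G.edgeSet ∧ IsForest T ∧
    ∀ e ∈ G.edgeSet, e ∉ T → ¬ IsForest (insert e T)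

/-! ### The algorithm RandSimple -/

namespace RandSimple

/-- A message is an edge or a dummy message. -/
inductive Msg (n : ℕ) : Type
  | edge (e : Sym2 (Fin n)) : Msg n
  | dummy : Msg n

/-- The input of a station: its identifier and the edge it holds. -/
structure Input (n : ℕ) : Type where
  id : ℕ
  edge : Sym2 (Fin n)

inductive Status : Type
  | waiting | revealed | cycle

/-- The next broadcasting step (A, C or D) in the main loop; `done` after termination. -/
inductive Label : Type
  | A | C | D | done

/-- The memory of a station; `status` is the status of its own edge, and `revealed` is the set of
the edges that it knows to be revealed. -/
structure Memory (n : ℕ) : Type where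
  label : Label
  a : ℚ
  counter : ℕ
  status : Status
  revealed : Finset (Sym2 (Fin n))

open Classical in
/-- The set of revealed edges after `e` has been heard. A heard edge is new to this set unless it
is already revealed or it is a cycle edge (step C broadcasts edges of any status). -/
noncomputable def addRevealed {n : ℕ} (R : Finset (Sym2 (Fin n))) (e : Sym2 (Fin n)) :
    Finset (Sym2 (Fin n)) :=
  if IsForest (insert e R) then insert e R else R

open Classical in
/-- The new status of the edge `own` when the edge `e` has been heard and `R` is the resulting set
of revealed edges. Only a waiting edge changes its status: to revealed if it was heard itself, and
to cycle if another edge was heard and `own` now makes a cycle with the revealed edges. -/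
noncomputable def newStatus {n : ℕ} (own e : Sym2 (Fin n)) (R : Finset (Sym2 (Fin n))) :
    Status → Status
  | .waiting => if e = own then .revealed else if IsForest (insert own R) then .waiting else .cycle
  | .revealed => .revealed
  | .cycle => .cycle

/-- A station that holds `own` hears the edge `e`. -/
noncomputable def hear {n : ℕ} (own : Sym2 (Fin n)) (s : Memory n) (e : Sym2 (Fin n)) : Memory n :=
  { s with
    revealed := addRevealed s.revealed e
    status := newStatus own e (addRevealed s.revealed e) s.status }

/-- Reaction to the feedback of step A. -/
noncomputable def afterA {n : ℕ} (own : Sym2 (Fin n)) (s : Memory n) :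
    Feedback (Msg n) → Memory n
  | .heard (.edge e) => hear own s e
  | .heard .dummy => s
  | .noise => { s with a := 3 * s.a }
  | .silence => { s with a := max (s.a / 3) 1 }

/-- Reaction to the feedback of step C. -/
noncomputable def afterC {n : ℕ} (own : Sym2 (Fin n)) (s : Memory n) :
    Feedback (Msg n) → Memory n
  | .heard (.edge e) => hear own s e
  | .heard .dummy => s
  | .noise => s
  | .silence => s

/-- The label after step D: the main loop is repeated until silence is heard in step D. -/
def afterD {n : ℕ} : Feedback (Msg n) → Label
  | .silence => .done
  | .heard _ => .A
  | .noise => .A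

open Classical in
/-- The probability with which a station broadcasts. Step A: a waiting station, with probability
`1/a`; step C: the station whose identifier is the counter; step D: all waiting stations. -/
noncomputable def prob {n : ℕ} (i : Input n) (s : Memory n) : ℝ :=
  match s.label with
  | .A => if s.status = .waiting then ((1 / s.a : ℚ) : ℝ) else 0
  | .C => if i.id = s.counter then 1 else 0
  | .D => if s.status = .waiting then 1 else 0
  | .done => 0

/-- The message that a station sends if it broadcasts. -/
def msg {n : ℕ} (i : Input n) (s : Memory n) : Msg n :=
  match s.label with
  | .A => .edge i.edge
  | .C => .edge i.edge
  | .D => .dummy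
  | .done => .dummy

noncomputable def next {n : ℕ} (i : Input n) (s : Memory n) (f : Feedback (Msg n)) : Memory n :=
  match s.label with
  | .A => { afterA i.edge s f with counter := s.counter + 1, label := .C }
  | .C => { afterC i.edge s f with label := .D }
  | .D => { s with label := afterD f }
  | .done => s

/-- The algorithm RandSimple. -/
noncomputable def algorithm (n : ℕ) : Protocol (Input n) (Memory n) (Msg n) where
  init := { label := .A, a := 1, counter := 0, status := .waiting, revealed := ∅ }
  prob := prob
  msg := msg
  next := next
  halted := fun s => s.label = .done

/-- The distributed input: the edges of `G` are held by `m` stations, one edge each; the station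
with index `p` in `{0,…,m-1}` has the identifier `p + 1`. -/
def input {n m : ℕ} {G : SimpleGraph (Fin n)} (edge : Fin m ≃ G.edgeSet) (p : Fin m) : Input n where
  id := p + 1
  edge := edge p

end RandSimple

/-!
A heard edge is processed in the same way by all stations, and a waiting edge is one that can be
added to the forest `R` of the revealed edges; hence the stations share a common state, which
evolves as a Markov chain driven by the trials. No edge is waiting any more once the stations have
all been called in step C, so the `m`-th round is the last one.

The mean running time is bounded by a potential that drops in the mean by at least one per step,
`3 * (15 * (|T| - |R|) + Φ(w, j))` plus the number of steps left in the round. Here `w` is the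
number of waiting edges, `a = 3 ^ j`, and `Φ(w, j) = j + 2 * max (⌈log₃ (2 * w)⌉ - j) 0`. While `j`
is below the target `⌈log₃ (2 * w)⌉` silence is rare compared with success, so `j` climbs; beyond
it collisions are, so `j` falls; and at the target a success is likely, which pays for the change
of `Φ`. At the start the potential is `O(|T| + log m)`, and this is `O(|T|)` because the edges of
`T` meet at most `2 * |T|` vertices, so that `m ≤ |T| * (2 * |T| + 1)`.
-/

/-! ### Forests and the incidence space of a graph -/

section Forests

variable {V : Type}

theorem IsForest.anti {R S : Finset (Sym2 V)} (h : R ⊆ S) (hS : IsForest S) : IsForest R :=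
  SimpleGraph.IsAcyclic.anti (SimpleGraph.fromEdgeSet_mono (by exact_mod_cast h)) hS

theorem isForest_empty : IsForest (∅ : Finset (Sym2 V)) := by
  simp [IsForest]

theorem isForest_singleton (e : Sym2 V) : IsForest {e} := by
  induction e with
  | _ u v =>
    rw [IsForest, Finset.coe_singleton, ← SimpleGraph.edge,
      ← bot_sup_eq (SimpleGraph.edge u v), SimpleGraph.isAcyclic_sup_fromEdgeSet_iff]
    simp +contextual

theorem fromEdgeSet_insert [DecidableEq V] (R : Finset (Sym2 V)) (u v : V) :
    SimpleGraph.fromEdgeSet ((insert s(u, v) R : Finset (Sym2 V)) : Set (Sym2 V)) =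
      SimpleGraph.fromEdgeSet (R : Set (Sym2 V)) ⊔ SimpleGraph.edge u v := by
  rw [Finset.coe_insert, Set.insert_eq, Set.union_comm, SimpleGraph.fromEdgeSet_union,
    SimpleGraph.edge]

theorem isForest_insert_iff [DecidableEq V] {R : Finset (Sym2 V)} {u v : V} (huv : u ≠ v)
    (he : s(u, v) ∉ R) :
    IsForest (insert s(u, v) R) ↔
      IsForest R ∧ ¬ (SimpleGraph.fromEdgeSet (R : Set (Sym2 V))).Reachable u v := by
  rw [IsForest, fromEdgeSet_insert, SimpleGraph.isAcyclic_sup_fromEdgeSet_iff]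
  simp [IsForest, huv, he]

/-- The space spanned by the differences `u - v` of adjacent vertices, i.e. the image of the
boundary map of `G`. The edges of a forest give a basis of it, so that its dimension compares the
sizes of forests. -/
noncomputable def edgeSpace (G : SimpleGraph V) : Submodule ℚ (V →₀ ℚ) :=
  Submodule.span ℚ {x | ∃ u v, G.Adj u v ∧ x = .single u 1 - .single v 1}

theorem edgeSpace_bot : edgeSpace (⊥ : SimpleGraph V) = ⊥ := by
  simp [edgeSpace]

theorem edgeSpace_edge {u v : V} (huv : u ≠ v) :
    edgeSpace (SimpleGraph.edge u v) = ℚ ∙ (.single u 1 - .single v 1 : V →₀ ℚ) := by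
  refine le_antisymm (Submodule.span_le.2 ?_) ?_
  · rintro _ ⟨a, b, hab, rfl⟩
    rcases (SimpleGraph.edge_adj ..).1 hab with ⟨⟨rfl, rfl⟩ | ⟨rfl, rfl⟩, -⟩
    · exact Submodule.mem_span_singleton_self _
    · exact Submodule.mem_span_singleton.2 ⟨-1, by simp⟩
  · rw [Submodule.span_singleton_le_iff_mem]
    exact Submodule.subset_span ⟨u, v, by simp [SimpleGraph.edge_adj, huv], rfl⟩

theorem edgeSpace_sup (G H : SimpleGraph V) : edgeSpace (G ⊔ H) = edgeSpace G ⊔ edgeSpace H := by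
  rw [edgeSpace, edgeSpace, edgeSpace, ← Submodule.span_union]
  congr 1
  ext x
  simp only [SimpleGraph.sup_adj, or_and_right, exists_or, Set.mem_ofPred_eq, Set.mem_union]

theorem single_sub_single_mem_edgeSpace_iff {G : SimpleGraph V} {u v : V} :
    (.single u 1 - .single v 1 : V →₀ ℚ) ∈ edgeSpace G ↔ G.Reachable u v := by
  classical
  constructor
  · contrapose!
    intro h hmem
    -- the sum of the coordinates over the component of `u` vanishes on `edgeSpace G`
    let φ : (V →₀ ℚ) →ₗ[ℚ] ℚ :=
      Finsupp.linearCombination ℚ fun w => if G.Reachable u w then 1 else 0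
    have hφ : edgeSpace G ≤ LinearMap.ker φ := by
      refine Submodule.span_le.2 ?_
      rintro _ ⟨a, b, hab, rfl⟩
      have : G.Reachable u a ↔ G.Reachable u b :=
        ⟨fun hr => hr.trans hab.reachable, fun hr => hr.trans hab.symm.reachable⟩
      simp [φ, this]
    simpa [φ, h] using hφ hmem
  · rintro ⟨p⟩
    induction p with
    | nil => simp
    | cons hadj _ ih =>
      rw [← sub_add_sub_cancel]
      exact add_mem (Submodule.subset_span ⟨_, _, hadj, rfl⟩) ih

theorem edgeSpace_le_of_adj_reachable {G H : SimpleGraph V}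
    (h : ∀ u v, G.Adj u v → H.Reachable u v) : edgeSpace G ≤ edgeSpace H := by
  refine Submodule.span_le.2 ?_
  rintro _ ⟨u, v, huv, rfl⟩
  exact single_sub_single_mem_edgeSpace_iff.2 (h u v huv)

theorem finiteDimensional_edgeSpace {R : Finset (Sym2 V)} (hd : ∀ e ∈ R, ¬ e.IsDiag) :
    FiniteDimensional ℚ (edgeSpace (SimpleGraph.fromEdgeSet (R : Set (Sym2 V)))) := by
  classical
  induction R using Finset.induction_on with
  | empty =>
    rw [Finset.coe_empty, SimpleGraph.fromEdgeSet_empty, edgeSpace_bot]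
    infer_instance
  | insert e R _ ih =>
    induction e with
    | _ u v =>
      have := ih fun e he => hd e (Finset.mem_insert_of_mem he)
      rw [fromEdgeSet_insert, edgeSpace_sup, edgeSpace_edge (by simpa using hd s(u, v) (by simp))]
      infer_instance

theorem IsForest.finrank_edgeSpace {R : Finset (Sym2 V)} (hR : IsForest R)
    (hd : ∀ e ∈ R, ¬ e.IsDiag) :
    Module.finrank ℚ (edgeSpace (SimpleGraph.fromEdgeSet (R : Set (Sym2 V)))) = R.card := by
  classical
  induction R using Finset.induction_on with
  | empty => rw [Finset.coe_empty, SimpleGraph.fromEdgeSet_empty, edgeSpace_bot, finrank_bot,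
      Finset.card_empty]
  | insert e R he ih =>
    induction e with
    | _ u v =>
      have huv : u ≠ v := by simpa using hd s(u, v) (by simp)
      have hd' : ∀ e ∈ R, ¬ e.IsDiag := fun e he => hd e (Finset.mem_insert_of_mem he)
      obtain ⟨hR', hr⟩ := (isForest_insert_iff huv he).1 hR
      have := finiteDimensional_edgeSpace hd'
      have hnot := single_sub_single_mem_edgeSpace_iff.not.2 hr
      rw [fromEdgeSet_insert, edgeSpace_sup, edgeSpace_edge huv, Finset.card_insert_of_notMem he,
        ← ih hR' hd',
        ← finrank_span_singleton (K := ℚ) (ne_of_mem_of_not_mem (zero_mem _) hnot).symm,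
        ← Submodule.finrank_sup_add_finrank_inf_eq,
        (Submodule.disjoint_span_singleton_of_notMem hnot).eq_bot, finrank_bot, add_zero]

variable [DecidableEq V] {G : SimpleGraph V} {R S T : Finset (Sym2 V)}

theorem IsSpanningForest.reachable (hT : IsSpanningForest G T) {u v : V} (h : G.Adj u v) :
    (SimpleGraph.fromEdgeSet (T : Set (Sym2 V))).Reachable u v := by
  by_cases he : s(u, v) ∈ T
  · exact SimpleGraph.Adj.reachable (by simp [he, h.ne])
  · by_contra hr
    exact hT.2.2 _ h he ((isForest_insert_iff h.ne he).2 ⟨hT.2.1, hr⟩)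

theorem IsForest.card_le_of_isSpanningForest (hR : IsForest R)
    (hRG : (R : Set (Sym2 V)) ⊆ G.edgeSet) (hT : IsSpanningForest G T) : R.card ≤ T.card := by
  have hdiag {S : Finset (Sym2 V)} (hS : (S : Set (Sym2 V)) ⊆ G.edgeSet) :
      ∀ e ∈ S, ¬ e.IsDiag := fun _ he => G.not_isDiag_of_mem_edgeSet (hS he)
  have := finiteDimensional_edgeSpace (hdiag hT.1)
  rw [← hR.finrank_edgeSpace (hdiag hRG), ← hT.2.1.finrank_edgeSpace (hdiag hT.1)]
  refine Submodule.finrank_mono (edgeSpace_le_of_adj_reachable fun u v huv => hT.reachable ?_)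
  exact (SimpleGraph.mem_edgeSet _).1 (hRG ((SimpleGraph.fromEdgeSet_adj _).1 huv).1)

theorem IsSpanningForest.card_eq (hS : IsSpanningForest G S) (hT : IsSpanningForest G T) :
    S.card = T.card :=
  le_antisymm (hS.2.1.card_le_of_isSpanningForest hS.1 hT)
    (hT.2.1.card_le_of_isSpanningForest hT.1 hS)

theorem IsSpanningForest.edgeSet_subset (hT : IsSpanningForest G T) :
    G.edgeSet ⊆ ((T.biUnion Sym2.toFinset).sym2 : Set (Sym2 V)) := by
  have covered {u v : V} (h : G.Adj u v) : u ∈ T.biUnion Sym2.toFinset := by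
    obtain ⟨p⟩ := hT.reachable h
    cases p with
    | nil => exact absurd h (G.loopless.irrefl _)
    | cons hadj _ =>
      exact Finset.mem_biUnion.2 ⟨_, ((SimpleGraph.fromEdgeSet_adj _).1 hadj).1, by simp⟩
  intro e he
  induction e with
  | _ u v => exact Finset.mk_mem_sym2_iff.2 ⟨covered he, covered (SimpleGraph.Adj.symm he)⟩

theorem IsSpanningForest.card_edgeSet_le (hT : IsSpanningForest G T) :
    Nat.card G.edgeSet ≤ T.card * (2 * T.card + 1) := by
  have hV : (T.biUnion Sym2.toFinset).card ≤ T.card * 2 :=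
    Finset.card_biUnion_le_card_mul _ _ _ fun e _ => by
      rw [Sym2.card_toFinset]
      split_ifs <;> simp
  calc Nat.card G.edgeSet
      ≤ Nat.card ((T.biUnion Sym2.toFinset).sym2 : Set (Sym2 V)) :=
        Nat.card_mono (Finset.finite_toSet _) hT.edgeSet_subset
    _ = ((T.biUnion Sym2.toFinset).card + 1).choose 2 := by
        rw [Nat.card_eq_card_toFinset, Finset.toFinset_coe, Finset.card_sym2]
    _ ≤ (2 * T.card + 1).choose 2 := Nat.choose_le_choose 2 (by lia)
    _ = T.card * (2 * T.card + 1) := by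
        rw [Nat.choose_two_right, Nat.add_sub_cancel]
        exact Nat.div_eq_of_eq_mul_right two_pos (by ring)

end Forests

/-! ### Feedback of the channel -/

section Channel

variable {ι M : Type} {b : ι → Prop} {msg : ι → M}

theorem channel_eq_silence_iff : channel b msg = .silence ↔ ∀ p, ¬ b p := by
  rw [channel]
  split_ifs with h1 h2
  · simpa using h1.exists
  · simpa using h2
  · simpa using h2

theorem channel_eq_heard_of_unique {p : ι} (hp : b p) (h : ∀ q, b q → q = p) :
    channel b msg = .heard (msg p) := by
  have h1 : ∃! p, b p := ⟨p, hp, h⟩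
  rw [channel, dif_pos h1, h _ h1.choose_spec.1]

theorem channel_eq_heard_iff {x : M} :
    channel b msg = .heard x ↔ ∃ p, b p ∧ msg p = x ∧ ∀ q, b q → q = p := by
  refine ⟨fun h => ?_, fun ⟨p, hp, hx, hu⟩ => hx ▸ channel_eq_heard_of_unique hp hu⟩
  rw [channel] at h
  split_ifs at h with h1
  exact ⟨h1.choose, h1.choose_spec.1, by simpa using h, h1.choose_spec.2⟩

end Channel

/-! ### Additive drift for iterated random maps -/

section Trajectory

variable {S E : Type*}

/-- The orbit of `s₀` under the maps `F (u 0)`, `F (u 1)`, …; when the `u t` are independent and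
identically distributed, this is a Markov chain. -/
def trajectory (F : E → S → S) (s₀ : S) (u : ℕ → E) : ℕ → S
  | 0 => s₀
  | t + 1 => F (u t) (trajectory F s₀ u t)

theorem trajectory_induction {F : E → S → S} {s₀ : S} {u : ℕ → E} {I : S → Prop} (h₀ : I s₀)
    (h : ∀ t s, I s → I (F (u t) s)) (t : ℕ) : I (trajectory F s₀ u t) := by
  induction t with
  | zero => exact h₀
  | succ t ih => exact h t _ ih

variable [MeasurableSpace S] [MeasurableSpace E] {F : E → S → S} (s₀ : S)

theorem measurable_trajectory {Ω : Type*} {mΩ : MeasurableSpace Ω} {U : ℕ → Ω → E}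
    (hF : Measurable (Function.uncurry F)) {t : ℕ} (hU : ∀ s < t, Measurable (U s)) :
    Measurable fun ω => trajectory F s₀ (U · ω) t := by
  induction t with
  | zero => exact measurable_const
  | succ t ih =>
    exact hF.comp ((hU t t.lt_succ_self).prodMk (ih fun s hs => hU s (hs.trans t.lt_succ_self)))

variable {Ω : Type*} [MeasurableSpace Ω] {P : Measure Ω} {U : ℕ → Ω → E} {μ : Measure E}

theorem indepFun_trajectory (hF : Measurable (Function.uncurry F)) (hU : ∀ t, Measurable (U t))
    (hind : iIndepFun U P) (t : ℕ) : IndepFun (fun ω => trajectory F s₀ (U · ω) t) (U t) P := by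
  have past_indep := indep_iSup_of_disjoint (fun t => (hU t).comap_le) hind
    (Set.disjoint_singleton_right.2 (Set.self_notMem_Iio (a := t)))
  rw [iSup_singleton] at past_indep
  refine indep_of_indep_of_le_left past_indep (Measurable.comap_le ?_)
  refine measurable_trajectory (mΩ := _) s₀ hF fun s hs => ?_
  exact (comap_measurable (U s)).mono (le_iSup₂_of_le s hs le_rfl) le_rfl

theorem lintegral_trajectory_succ [IsProbabilityMeasure P] (hF : Measurable (Function.uncurry F))
    (hU : ∀ t, Measurable (U t)) (hind : iIndepFun U P) (hlaw : ∀ t, P.map (U t) = μ)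
    {f : S → ℝ≥0∞} (hf : Measurable f) (t : ℕ) :
    ∫⁻ ω, f (trajectory F s₀ (U · ω) (t + 1)) ∂P =
      ∫⁻ ω, ∫⁻ x, f (F x (trajectory F s₀ (U · ω) t)) ∂μ ∂P := by
  have hX : Measurable fun ω => trajectory F s₀ (U · ω) t :=
    measurable_trajectory s₀ hF fun s _ => hU s
  have hg : Measurable fun y : S × E => f (F y.2 y.1) := hf.comp (hF.comp measurable_swap)
  have hmap := (indepFun_iff_map_prod_eq_prod_map_map hX.aemeasurable (hU t).aemeasurable).1
    (indepFun_trajectory s₀ hF hU hind t)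
  have : IsProbabilityMeasure μ := hlaw t ▸ Measure.isProbabilityMeasure_map (hU t).aemeasurable
  rw [hlaw t] at hmap
  calc ∫⁻ ω, f (trajectory F s₀ (U · ω) (t + 1)) ∂P
      = ∫⁻ y, f (F y.2 y.1) ∂(P.map fun ω => (trajectory F s₀ (U · ω) t, U t ω)) :=
        (lintegral_map hg (hX.prodMk (hU t))).symm
    _ = ∫⁻ s, ∫⁻ x, f (F x s) ∂μ ∂(P.map fun ω => trajectory F s₀ (U · ω) t) := by
        rw [hmap, lintegral_prod _ hg.aemeasurable]
    _ = _ := lintegral_map hg.lintegral_prod_right' hX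

/-- The Foster–Lyapunov criterion: the mean of the potential plus the mean of the cost paid so far
never grows. -/
theorem lintegral_tsum_cost_le [IsProbabilityMeasure P] {I : S → Prop} {Ψ c : S → ℝ≥0∞}
    (hF : Measurable (Function.uncurry F)) (hU : ∀ t, Measurable (U t)) (hind : iIndepFun U P)
    (hlaw : ∀ t, P.map (U t) = μ) (hI : ∀ᵐ ω ∂P, ∀ t, I (trajectory F s₀ (U · ω) t))
    (hΨ : Measurable Ψ) (hc : Measurable c)
    (hdrift : ∀ s, I s → ∫⁻ x, Ψ (F x s) ∂μ + c s ≤ Ψ s) :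
    ∫⁻ ω, ∑' t, c (trajectory F s₀ (U · ω) t) ∂P ≤ Ψ s₀ := by
  have hcost (t : ℕ) : Measurable fun ω => c (trajectory F s₀ (U · ω) t) :=
    hc.comp (measurable_trajectory s₀ hF fun s _ => hU s)
  have partial_sum_le (k : ℕ) :
      ∫⁻ ω, Ψ (trajectory F s₀ (U · ω) k) ∂P +
        ∑ t ∈ Finset.range k, ∫⁻ ω, c (trajectory F s₀ (U · ω) t) ∂P ≤ Ψ s₀ := by
    induction k with
    | zero => simp [trajectory]
    | succ k ih =>
      refine le_trans ?_ ih
      rw [Finset.sum_range_succ_comm, ← add_assoc, lintegral_trajectory_succ s₀ hF hU hind hlaw hΨ,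
        ← lintegral_add_right _ (hcost k)]
      gcongr ?_ + _
      refine lintegral_mono_ae ?_
      filter_upwards [hI] with ω hω using hdrift _ (hω k)
  rw [lintegral_tsum fun t => (hcost t).aemeasurable]
  exact ENNReal.tsum_le_of_sum_range_le fun k => le_add_self.trans (partial_sum_le k)

end Trajectory

theorem iIndepFun_curry {ι κ Ω α : Type*} [MeasurableSpace Ω] [MeasurableSpace α]
    {P : Measure Ω} {X : ι → κ → Ω → α} (hX : ∀ i j, Measurable (X i j))
    (h : iIndepFun (fun q : ι × κ => X q.1 q.2) P) : iIndepFun (fun i ω j => X i j ω) P := by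
  have := h.isProbabilityMeasure
  have (i : ι) (j : κ) : IsProbabilityMeasure (P.map (X i j)) :=
    Measure.isProbabilityMeasure_map (hX i j).aemeasurable
  rw [iIndepFun_iff_map_fun_eq_infinitePi_map fun i => measurable_pi_lambda _ (hX i)]
  have hrow (i : ι) : P.map (fun ω j => X i j ω) = Measure.infinitePi fun j => P.map (X i j) :=
    (h.precomp (Prod.mk_right_injective i)).map_fun_eq_infinitePi_map (hX i)
  have hall : P.map (fun ω (q : ι × κ) => X q.1 q.2 ω) =
      Measure.infinitePi fun q : ι × κ => P.map (X q.1 q.2) :=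
    h.map_fun_eq_infinitePi_map fun q => hX q.1 q.2
  simp_rw [hrow]
  rw [← Measure.infinitePi_map_curry (fun i j => P.map (X i j)), ← hall,
    Measure.map_map (MeasurableEquiv.measurable _)
      (measurable_pi_lambda _ fun q : ι × κ => hX q.1 q.2)]
  rfl

/-! ### Independent trials -/

section Trials

variable {ι α : Type*} {W : Finset ι} {A : Set α}

/-- The event that no trial in `W` succeeds, when the outcomes in `A` are successes. -/
def noSuccess (W : Finset ι) (A : Set α) : Set (ι → α) :=
  {x | ∀ p ∈ W, x p ∉ A}

/-- The event that the trial `p` is the only one in `W` that succeeds. -/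
def onlySuccess (W : Finset ι) (A : Set α) (p : ι) : Set (ι → α) :=
  {x | x p ∈ A ∧ ∀ q ∈ W, q ≠ p → x q ∉ A}

/-- The event that exactly one trial in `W` succeeds. -/
def oneSuccess (W : Finset ι) (A : Set α) : Set (ι → α) :=
  ⋃ p ∈ W, onlySuccess W A p

theorem disjoint_noSuccess_oneSuccess : Disjoint (noSuccess W A) (oneSuccess W A) := by
  refine Set.disjoint_left.2 fun x hx hx' => ?_
  obtain ⟨p, hp, hxp⟩ := Set.mem_iUnion₂.1 hx'
  exact hx p hp hxp.1

theorem pairwiseDisjoint_onlySuccess :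
    (W : Set ι).PairwiseDisjoint (onlySuccess W A) := fun p hp _ _ hne =>
  Set.disjoint_left.2 fun _ hx hx' => hx'.2 p hp hne hx.1

theorem onlySuccess_eq_pi [DecidableEq ι] {p : ι} (hp : p ∈ W) :
    onlySuccess W A p = (W : Set ι).pi (Function.update (fun _ => Aᶜ) p A) := by
  ext x
  constructor
  · rintro ⟨hxp, hx⟩ q hq
    rcases eq_or_ne q p with rfl | hqp
    · simpa using hxp
    · simpa [hqp] using hx q hq hqp
  · exact fun hx => ⟨by simpa using hx p hp, fun q hq hqp => by simpa [hqp] using hx q hq⟩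

variable [MeasurableSpace α]

theorem measurableSet_noSuccess (hA : MeasurableSet A) : MeasurableSet (noSuccess W A) := by
  have : noSuccess W A = ⋂ p ∈ W, (fun x => x p) ⁻¹' Aᶜ := by ext; simp [noSuccess]
  rw [this]
  exact W.measurableSet_biInter fun p _ => measurable_pi_apply p hA.compl

theorem measurableSet_onlySuccess (hA : MeasurableSet A) {p : ι} (hp : p ∈ W) :
    MeasurableSet (onlySuccess W A p) := by
  classical
  rw [onlySuccess_eq_pi hp]
  refine .pi W.countable_toSet fun q _ => ?_
  rcases eq_or_ne q p with rfl | hqp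
  · simpa using hA
  · simpa [hqp] using hA.compl

theorem measurableSet_oneSuccess (hA : MeasurableSet A) : MeasurableSet (oneSuccess W A) :=
  W.measurableSet_biUnion fun _ hp => measurableSet_onlySuccess hA hp

variable {μ : Measure α} [IsProbabilityMeasure μ]

theorem infinitePi_noSuccess (hA : MeasurableSet A) :
    Measure.infinitePi (fun _ : ι => μ) (noSuccess W A) = μ Aᶜ ^ W.card :=
  (Measure.infinitePi_pi (t := fun _ => Aᶜ) _ fun _ _ => hA.compl).trans (Finset.prod_const _)

theorem infinitePi_onlySuccess (hA : MeasurableSet A) {p : ι} (hp : p ∈ W) :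
    Measure.infinitePi (fun _ : ι => μ) (onlySuccess W A p) = μ A * μ Aᶜ ^ (W.card - 1) := by
  classical
  rw [onlySuccess_eq_pi hp, Measure.infinitePi_pi]
  · simp_rw [Function.apply_update fun _ => μ]
    rw [Finset.prod_update_of_mem hp, Finset.prod_const, Finset.card_sdiff_of_subset (by simpa),
      Finset.card_singleton]
  · intro q _
    rcases eq_or_ne q p with rfl | hqp
    · simpa using hA
    · simpa [hqp] using hA.compl

theorem infinitePi_oneSuccess (hA : MeasurableSet A) :
    Measure.infinitePi (fun _ : ι => μ) (oneSuccess W A) =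
      W.card * (μ A * μ Aᶜ ^ (W.card - 1)) := by
  rw [oneSuccess, measure_biUnion_finset pairwiseDisjoint_onlySuccess
      fun _ hp => measurableSet_onlySuccess hA hp,
    Finset.sum_congr rfl fun p hp => infinitePi_onlySuccess hA hp, Finset.sum_const, nsmul_eq_mul]

end Trials

theorem lintegral_le_of_le_on_partition {Ω : Type*} [MeasurableSpace Ω] {P : Measure Ω}
    {s t : Set Ω} (hs : MeasurableSet s) (ht : MeasurableSet t) (hst : Disjoint s t)
    {f : Ω → ℝ≥0∞} {a b c : ℝ≥0∞} (ha : ∀ᵐ x ∂P, x ∈ s → f x ≤ a)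
    (hb : ∀ᵐ x ∂P, x ∈ t → f x ≤ b) (hc : ∀ᵐ x ∂P, x ∉ s → x ∉ t → f x ≤ c) :
    ∫⁻ x, f x ∂P ≤ a * P s + b * P t + c * P (s ∪ t)ᶜ := by
  have setLIntegral_le {r : Set Ω} (hr : MeasurableSet r) {d : ℝ≥0∞}
      (h : ∀ᵐ x ∂P, x ∈ r → f x ≤ d) : ∫⁻ x in r, f x ∂P ≤ d * P r :=
    (setLIntegral_mono_ae' hr h).trans_eq (setLIntegral_const r d)
  rw [← lintegral_add_compl f (hs.union ht), lintegral_union ht hst]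
  gcongr
  · exact setLIntegral_le hs ha
  · exact setLIntegral_le ht hb
  · refine setLIntegral_le (hs.union ht).compl ?_
    filter_upwards [hc] with x hx hxst
    rw [Set.mem_compl_iff, Set.mem_union, not_or] at hxst
    exact hx hxst.1 hxst.2

theorem lintegral_natCast_add_one_le {Ω : Type*} [MeasurableSpace Ω] {P : Measure Ω}
    [IsProbabilityMeasure P] {f : Ω → ℕ} {k : ℕ} (h : ∀ x, f x + 1 ≤ k) :
    ∫⁻ x, (f x : ℝ≥0∞) ∂P + 1 ≤ k := by
  calc ∫⁻ x, (f x : ℝ≥0∞) ∂P + 1 = ∫⁻ x, ((f x : ℝ≥0∞) + 1) ∂P := by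
        rw [lintegral_add_right _ measurable_const, lintegral_one, measure_univ]
    _ ≤ ∫⁻ _, (k : ℝ≥0∞) ∂P := lintegral_mono fun x => by
        rw [← Nat.cast_add_one]
        exact Nat.cast_le.2 (h x)
    _ = k := by rw [lintegral_const, measure_univ, mul_one]

/-! ### Uniform trials with a common success probability -/

/-- The uniform distribution on `[0,1)`. -/
noncomputable def uniformUnit : Measure ℝ := cond volume (Set.Ico (0 : ℝ) 1)

instance : IsProbabilityMeasure uniformUnit :=
  cond_isProbabilityMeasure_of_finite (by simp) (by simp)

theorem ae_mem_Ico_uniformUnit : ∀ᵐ y ∂uniformUnit, y ∈ Set.Ico (0 : ℝ) 1 :=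
  ae_cond_mem measurableSet_Ico

theorem uniformUnit_Iio {q : ℝ} (hq : q ≤ 1) : uniformUnit (Set.Iio q) = ENNReal.ofReal q := by
  rw [uniformUnit, cond_apply measurableSet_Ico, Set.Ico_inter_Iio, min_eq_right hq,
    Real.volume_Ico, Real.volume_Ico]
  simp

theorem uniformUnit_compl_Iio {q : ℝ} (hq₀ : 0 ≤ q) (hq : q ≤ 1) :
    uniformUnit (Set.Iio q)ᶜ = ENNReal.ofReal (1 - q) := by
  rw [prob_compl_eq_one_sub measurableSet_Iio, uniformUnit_Iio hq, ENNReal.ofReal_sub _ hq₀,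
    ENNReal.ofReal_one]

/-- The distribution of the trials of all the stations in one step. -/
noncomputable def trials (ι : Type*) : Measure (ι → ℝ) :=
  Measure.infinitePi fun _ => uniformUnit

instance (ι : Type*) : IsProbabilityMeasure (trials ι) :=
  inferInstanceAs (IsProbabilityMeasure (Measure.infinitePi _))

theorem ae_mem_Ico_trials {ι : Type*} [Countable ι] :
    ∀ᵐ x ∂trials ι, ∀ p, x p ∈ Set.Ico (0 : ℝ) 1 :=
  ae_all_iff.2 fun p => (measurePreserving_eval_infinitePi (fun _ : ι => uniformUnit) p
    ).quasiMeasurePreserving.ae ae_mem_Ico_uniformUnit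

/-- The probability that none of `w` independent trials of success probability `q` succeeds. -/
def noSuccessProb (w : ℕ) (q : ℝ) : ℝ := (1 - q) ^ w

/-- The probability that exactly one of `w` independent trials of success probability `q`
succeeds. -/
def oneSuccessProb (w : ℕ) (q : ℝ) : ℝ := w * (q * (1 - q) ^ (w - 1))

section UniformTrials

variable {ι : Type*} (W : Finset ι) {w : ℕ} {q : ℝ}

theorem noSuccessProb_nonneg (hq : q ≤ 1) : 0 ≤ noSuccessProb w q :=
  pow_nonneg (sub_nonneg.2 hq) _

theorem oneSuccessProb_nonneg (hq₀ : 0 ≤ q) (hq : q ≤ 1) : 0 ≤ oneSuccessProb w q :=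
  mul_nonneg w.cast_nonneg (mul_nonneg hq₀ (pow_nonneg (sub_nonneg.2 hq) _))

theorem trials_noSuccess (hq₀ : 0 ≤ q) (hq : q ≤ 1) :
    trials ι (noSuccess W (Set.Iio q)) = ENNReal.ofReal (noSuccessProb W.card q) := by
  rw [trials, infinitePi_noSuccess measurableSet_Iio, uniformUnit_compl_Iio hq₀ hq,
    noSuccessProb, ENNReal.ofReal_pow (sub_nonneg.2 hq)]

theorem trials_oneSuccess (hq₀ : 0 ≤ q) (hq : q ≤ 1) :
    trials ι (oneSuccess W (Set.Iio q)) = ENNReal.ofReal (oneSuccessProb W.card q) := by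
  rw [trials, infinitePi_oneSuccess measurableSet_Iio, uniformUnit_compl_Iio hq₀ hq,
    uniformUnit_Iio hq, oneSuccessProb, ENNReal.ofReal_mul (Nat.cast_nonneg _),
    ENNReal.ofReal_mul hq₀, ENNReal.ofReal_pow (sub_nonneg.2 hq), ENNReal.ofReal_natCast]

theorem trials_union (hq₀ : 0 ≤ q) (hq : q ≤ 1) :
    trials ι (noSuccess W (Set.Iio q) ∪ oneSuccess W (Set.Iio q)) =
      ENNReal.ofReal (noSuccessProb W.card q + oneSuccessProb W.card q) := by
  rw [measure_union disjoint_noSuccess_oneSuccess (measurableSet_oneSuccess measurableSet_Iio),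
    trials_noSuccess W hq₀ hq, trials_oneSuccess W hq₀ hq,
    ← ENNReal.ofReal_add (noSuccessProb_nonneg hq) (oneSuccessProb_nonneg hq₀ hq)]

theorem trials_compl_union (hq₀ : 0 ≤ q) (hq : q ≤ 1) :
    trials ι (noSuccess W (Set.Iio q) ∪ oneSuccess W (Set.Iio q))ᶜ =
      ENNReal.ofReal (1 - noSuccessProb W.card q - oneSuccessProb W.card q) := by
  rw [prob_compl_eq_one_sub ((measurableSet_noSuccess measurableSet_Iio).union
      (measurableSet_oneSuccess measurableSet_Iio)), trials_union W hq₀ hq, sub_sub,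
    ENNReal.ofReal_sub _ (add_nonneg (noSuccessProb_nonneg hq) (oneSuccessProb_nonneg hq₀ hq)),
    ENNReal.ofReal_one]

theorem lintegral_natCast_trials_le (hq₀ : 0 ≤ q) (hq : q ≤ 1) {f : (ι → ℝ) → ℕ} {a b c : ℕ}
    (ha : ∀ᵐ x ∂trials ι, x ∈ noSuccess W (Set.Iio q) → f x ≤ a)
    (hb : ∀ᵐ x ∂trials ι, x ∈ oneSuccess W (Set.Iio q) → f x ≤ b)
    (hc : ∀ᵐ x ∂trials ι, x ∉ noSuccess W (Set.Iio q) → x ∉ oneSuccess W (Set.Iio q) → f x ≤ c) :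
    ∫⁻ x, f x ∂trials ι ≤ ENNReal.ofReal (noSuccessProb W.card q * a + oneSuccessProb W.card q * b +
      (1 - noSuccessProb W.card q - oneSuccessProb W.card q) * c) := by
  have hz := noSuccessProb_nonneg (w := W.card) hq
  have hs := oneSuccessProb_nonneg (w := W.card) hq₀ hq
  have hzs : noSuccessProb W.card q + oneSuccessProb W.card q ≤ 1 := by
    rw [← ENNReal.ofReal_le_one, ← trials_union W hq₀ hq]
    exact prob_le_one
  refine (lintegral_le_of_le_on_partition (a := a) (b := b) (c := c)
    (measurableSet_noSuccess measurableSet_Iio) (measurableSet_oneSuccess measurableSet_Iio)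
    disjoint_noSuccess_oneSuccess (by simpa only [Nat.cast_le]) (by simpa only [Nat.cast_le])
    (by simpa only [Nat.cast_le])).trans_eq ?_
  rw [trials_noSuccess W hq₀ hq, trials_oneSuccess W hq₀ hq, trials_compl_union W hq₀ hq,
    ENNReal.ofReal_add (by positivity) (mul_nonneg (by linarith) c.cast_nonneg),
    ENNReal.ofReal_add (by positivity) (by positivity), ENNReal.ofReal_mul' a.cast_nonneg,
    ENNReal.ofReal_mul' b.cast_nonneg, ENNReal.ofReal_mul' c.cast_nonneg]
  simp only [ENNReal.ofReal_natCast, mul_comm]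

end UniformTrials

/-! ### The drift of the backoff -/

/-- The potential of the backoff when `w` stations broadcast with probability `1 / 3 ^ j`. The
target value of `j` is `⌈log₃ (2 w)⌉`; below it a step up gains `1`, and above it a step down. -/
def backoffPotential (w j : ℕ) : ℕ := j + 2 * (Nat.clog 3 (2 * w) - j)

theorem backoffPotential_mono {v w : ℕ} (h : v ≤ w) (j : ℕ) :
    backoffPotential v j ≤ backoffPotential w j :=
  Nat.add_le_add_left (Nat.mul_le_mul_left 2 (Nat.sub_le_sub_right
    (Nat.clog_mono_right 3 (Nat.mul_le_mul_left 2 h)) j)) j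

section Backoff

variable {w j : ℕ} {q : ℝ}

theorem backoffPotential_succ_of_lt (h : j < Nat.clog 3 (2 * w)) :
    (backoffPotential w (j + 1) : ℝ) = backoffPotential w j - 1 := by
  rw [eq_sub_iff_add_eq]
  norm_cast
  unfold backoffPotential
  omega

theorem backoffPotential_succ_of_le (h : Nat.clog 3 (2 * w) ≤ j) :
    (backoffPotential w (j + 1) : ℝ) = backoffPotential w j + 1 := by
  norm_cast
  unfold backoffPotential
  omega

theorem noSuccessProb_le_six_mul_oneSuccessProb (hw : 1 ≤ w) (hq₀ : 0 ≤ q) (hq : q ≤ 1)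
    (h : 1 ≤ 6 * (w * q)) : noSuccessProb w q ≤ 6 * oneSuccessProb w q := by
  have : 0 ≤ (1 - q) ^ (w - 1) := pow_nonneg (sub_nonneg.2 hq) _
  calc noSuccessProb w q = (1 - q) * (1 - q) ^ (w - 1) := by
        rw [noSuccessProb, ← pow_succ', Nat.sub_add_cancel hw]
    _ ≤ 6 * (w * q) * (1 - q) ^ (w - 1) := by gcongr; linarith
    _ = 6 * oneSuccessProb w q := by rw [oneSuccessProb]; ring

theorem one_sub_noSuccessProb_sub_oneSuccessProb_le (hw : 1 ≤ w) (hq₀ : 0 ≤ q)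
    (h : w * q ≤ 1 / 2) : 1 - noSuccessProb w q - oneSuccessProb w q ≤ oneSuccessProb w q := by
  have hw' : (1 : ℝ) ≤ w := by exact_mod_cast hw
  have bernoulli (k : ℕ) : 1 - k * q ≤ (1 - q) ^ k := by
    have := one_add_mul_le_pow (show (-2 : ℝ) ≤ -q by nlinarith) k
    rwa [mul_neg, ← sub_eq_add_neg, ← sub_eq_add_neg] at this
  have hz : 1 - w * q ≤ noSuccessProb w q := bernoulli w
  have hs : w * q ≤ 2 * oneSuccessProb w q := by
    have hpow : (1 : ℝ) / 2 ≤ (1 - q) ^ (w - 1) := by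
      have := bernoulli (w - 1)
      rw [Nat.cast_sub hw, Nat.cast_one] at this
      linarith
    calc w * q = 2 * (w * (q * (1 / 2))) := by ring
      _ ≤ 2 * oneSuccessProb w q := by unfold oneSuccessProb; gcongr
  linarith

theorem one_le_six_mul_of_le_clog (hw : 1 ≤ w) (h : j ≤ Nat.clog 3 (2 * w)) :
    (1 : ℝ) ≤ 6 * (w * ((3 : ℝ) ^ j)⁻¹) := by
  rw [← mul_assoc, ← div_eq_mul_inv, one_le_div₀ (by positivity)]
  norm_cast
  rcases j with _ | j
  · omega
  · have : 3 ^ j < 2 * w := (Nat.lt_clog_iff_pow_lt (by norm_num)).1 h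
    omega

theorem mul_le_half_of_clog_le (h : Nat.clog 3 (2 * w) ≤ j) :
    w * ((3 : ℝ) ^ j)⁻¹ ≤ 1 / 2 := by
  have : (2 * w : ℝ) ≤ 3 ^ j := by
    exact_mod_cast (Nat.clog_le_iff_le_pow (by norm_num)).1 h
  rw [← div_eq_mul_inv, div_le_iff₀ (by positivity)]
  linarith

/-- Up to the target value of `j` silence is at most `6` times as likely as a success, and from
the target on a collision is at most as likely. At the target the potential grows in both cases,
but then a success has probability at least `1 / 8`; hence a gain of `15` per success suffices. -/
theorem backoff_drift (hw : 1 ≤ w) (hq : q = ((3 : ℝ) ^ j)⁻¹) :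
    noSuccessProb w q * backoffPotential w (j - 1) +
      oneSuccessProb w q * (backoffPotential w j - 15) +
      (1 - noSuccessProb w q - oneSuccessProb w q) * backoffPotential w (j + 1) + 1 ≤
        backoffPotential w j := by
  have hq₀ : 0 ≤ q := by rw [hq]; positivity
  have hq₁ : q ≤ 1 := by rw [hq]; exact inv_le_one_of_one_le₀ (one_le_pow₀ (by norm_num))
  have hs := oneSuccessProb_nonneg (w := w) hq₀ hq₁
  have few_silences (h : j ≤ Nat.clog 3 (2 * w)) : noSuccessProb w q ≤ 6 * oneSuccessProb w q :=
    noSuccessProb_le_six_mul_oneSuccessProb hw hq₀ hq₁ (hq ▸ one_le_six_mul_of_le_clog hw h)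
  have few_collisions (h : Nat.clog 3 (2 * w) ≤ j) :
      1 - noSuccessProb w q - oneSuccessProb w q ≤ oneSuccessProb w q :=
    one_sub_noSuccessProb_sub_oneSuccessProb_le hw hq₀ (hq ▸ mul_le_half_of_clog_le h)
  rcases lt_or_ge j (Nat.clog 3 (2 * w)) with hj | hj
  · have hz := few_silences hj.le
    rw [backoffPotential_succ_of_lt hj]
    rcases j with _ | i
    · have : noSuccessProb w q = 0 := by simp [noSuccessProb, hq, Nat.ne_of_gt hw]
      rw [this]
      linarith
    · rw [Nat.add_sub_cancel, backoffPotential_succ_of_lt (i.lt_succ_self.trans hj)]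
      linarith
  · have hn := few_collisions hj
    rw [backoffPotential_succ_of_le hj]
    obtain ⟨i, rfl⟩ : ∃ i, j = i + 1 :=
      Nat.exists_eq_add_one.2 ((Nat.clog_pos (by norm_num) (by omega)).trans_le hj)
    rw [Nat.add_sub_cancel]
    rcases hj.eq_or_lt with hj | hj
    · have hz := few_silences hj.ge
      rw [backoffPotential_succ_of_lt (hj ▸ i.lt_succ_self)]
      linarith
    · rw [backoffPotential_succ_of_le (Nat.le_of_lt_succ hj)]
      linarith

end Backoff

namespace RandSimple

/-! ### The common state of the stations -/

section RevealedEdges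

variable {n : ℕ} {R S : Finset (Sym2 (Fin n))} {e own : Sym2 (Fin n)}

/-- An edge is waiting iff it can be added to the forest of revealed edges. -/
def IsWaiting (R : Finset (Sym2 (Fin n))) (e : Sym2 (Fin n)) : Prop :=
  e ∉ R ∧ IsForest (insert e R)

theorem IsWaiting.anti (h : R ⊆ S) (hS : IsWaiting S e) : IsWaiting R e :=
  ⟨fun he => hS.1 (h he), hS.2.anti (Finset.insert_subset_insert _ h)⟩

open Classical in
/-- The status of an edge, as determined by the set of revealed edges. -/
noncomputable def statusOf (R : Finset (Sym2 (Fin n))) (e : Sym2 (Fin n)) : Status :=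
  if e ∈ R then .revealed else if IsForest (insert e R) then .waiting else .cycle

theorem statusOf_eq_waiting_iff : statusOf R e = .waiting ↔ IsWaiting R e := by
  unfold statusOf IsWaiting
  split_ifs <;> simp_all

theorem statusOf_eq_revealed_iff : statusOf R e = .revealed ↔ e ∈ R := by
  unfold statusOf
  split_ifs <;> simp_all

theorem subset_addRevealed : R ⊆ addRevealed R e := by
  unfold addRevealed
  split_ifs
  · exact Finset.subset_insert _ _
  · exact subset_rfl

theorem mem_addRevealed_iff :
    own ∈ addRevealed R e ↔ own ∈ R ∨ own = e ∧ IsForest (insert e R) := by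
  unfold addRevealed
  split_ifs with h <;> simp [h, or_comm]

theorem isForest_addRevealed (hR : IsForest R) : IsForest (addRevealed R e) := by
  unfold addRevealed
  split_ifs with h
  exacts [h, hR]

theorem not_isWaiting_addRevealed : ¬ IsWaiting (addRevealed R e) e := by
  unfold addRevealed
  split_ifs with h
  · exact fun h' => h'.1 (Finset.mem_insert_self _ _)
  · exact fun h' => h h'.2

theorem newStatus_statusOf :
    newStatus own e (addRevealed R e) (statusOf R own) = statusOf (addRevealed R e) own := by
  have hanti (h : IsForest (insert own (addRevealed R e))) : IsForest (insert own R) :=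
    h.anti (Finset.insert_subset_insert _ subset_addRevealed)
  by_cases hmem : own ∈ R
  · simp [statusOf, newStatus, mem_addRevealed_iff, hmem]
  by_cases hown : e = own
  · subst hown
    by_cases hforest : IsForest (insert e R)
    · simp [statusOf, newStatus, mem_addRevealed_iff, hmem, hforest]
    · simp [statusOf, newStatus, mem_addRevealed_iff, hmem, hforest, mt hanti hforest]
  · by_cases hforest : IsForest (insert own R)
    · simp [statusOf, newStatus, mem_addRevealed_iff, hmem, hforest, hown, Ne.symm hown]
    · simp [statusOf, newStatus, mem_addRevealed_iff, hmem, hforest, Ne.symm hown,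
        mt hanti hforest]

/-- The set of revealed edges after a feedback. -/
noncomputable def revealedAfter (R : Finset (Sym2 (Fin n))) :
    Feedback (Msg n) → Finset (Sym2 (Fin n))
  | .heard (.edge e) => addRevealed R e
  | .heard .dummy => R
  | .noise => R
  | .silence => R

theorem subset_revealedAfter (f : Feedback (Msg n)) : R ⊆ revealedAfter R f := by
  rcases f with _ | (_ | _) | _
  exacts [subset_rfl, subset_addRevealed, subset_rfl, subset_rfl]

theorem mem_revealedAfter {f : Feedback (Msg n)} (h : e ∈ revealedAfter R f) :
    e ∈ R ∨ f = .heard (.edge e) := by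
  rcases f with _ | (e' | _) | _
  · exact .inl h
  · exact (mem_addRevealed_iff.1 h).imp_right fun h => by rw [h.1]
  · exact .inl h
  · exact .inl h

theorem isForest_revealedAfter (hR : IsForest R) (f : Feedback (Msg n)) :
    IsForest (revealedAfter R f) := by
  rcases f with _ | (_ | _) | _
  exacts [hR, isForest_addRevealed hR, hR, hR]

end RevealedEdges

/-- The exponent of `a` after a feedback in step A. -/
def expAfter {n : ℕ} (j : ℕ) : Feedback (Msg n) → ℕ
  | .heard _ => j
  | .noise => j + 1
  | .silence => j - 1

theorem max_three_pow_div_three (j : ℕ) : max ((3 : ℚ) ^ j / 3) 1 = 3 ^ (j - 1) := by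
  cases j with
  | zero => norm_num
  | succ j =>
    rw [pow_succ, mul_div_cancel_right₀ _ (by norm_num), Nat.add_sub_cancel]
    exact max_eq_left (one_le_pow₀ (by norm_num))

/-- The part of the memory that all the stations share; the number `a` is `3 ^ exp`. -/
structure State (n : ℕ) : Type where
  label : Label
  exp : ℕ
  counter : ℕ
  revealed : Finset (Sym2 (Fin n))

namespace State

variable {n : ℕ} {g : State n}

/-- The memory, in the common state `g`, of the station that holds `e`. -/
noncomputable def view (g : State n) (e : Sym2 (Fin n)) : Memory n where
  label := g.label
  a := 3 ^ g.exp
  counter := g.counter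
  status := statusOf g.revealed e
  revealed := g.revealed

/-- The initial common state. -/
def init (n : ℕ) : State n := ⟨.A, 0, 0, ∅⟩

/-- The common state after a feedback. -/
noncomputable def next (g : State n) (f : Feedback (Msg n)) : State n :=
  match g.label with
  | .A => ⟨.C, expAfter g.exp f, g.counter + 1, revealedAfter g.revealed f⟩
  | .C => ⟨.D, g.exp, g.counter, revealedAfter g.revealed f⟩
  | .D => ⟨afterD f, g.exp, g.counter, g.revealed⟩
  | .done => g

theorem view_init (e : Sym2 (Fin n)) : (init n).view e = (algorithm n).init := by
  simp [view, init, algorithm, statusOf, isForest_singleton]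

theorem next_view (i : Input n) (g : State n) (f : Feedback (Msg n)) :
    RandSimple.next i (g.view i.edge) f = (g.next f).view i.edge := by
  obtain ⟨_ | _ | _ | _, j, c, R⟩ := g
  · rcases f with _ | (e | _) | _ <;>
      simp [RandSimple.next, view, next, afterA, hear, expAfter, revealedAfter,
        newStatus_statusOf, max_three_pow_div_three, pow_succ']
  · rcases f with _ | (e | _) | _ <;>
      simp [RandSimple.next, view, next, afterC, hear, revealedAfter, newStatus_statusOf]
  · rfl
  · rfl

theorem revealed_subset_next (f : Feedback (Msg n)) : g.revealed ⊆ (g.next f).revealed := by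
  obtain ⟨_ | _ | _ | _, j, c, R⟩ := g
  exacts [subset_revealedAfter f, subset_revealedAfter f, subset_rfl, subset_rfl]

theorem mem_revealed_next {f : Feedback (Msg n)} {e : Sym2 (Fin n)}
    (h : e ∈ (g.next f).revealed) : e ∈ g.revealed ∨ f = .heard (.edge e) := by
  obtain ⟨_ | _ | _ | _, j, c, R⟩ := g
  exacts [mem_revealedAfter h, mem_revealedAfter h, .inl h, .inl h]

theorem isForest_revealed_next (hg : IsForest g.revealed) (f : Feedback (Msg n)) :
    IsForest (g.next f).revealed := by
  obtain ⟨_ | _ | _ | _, j, c, R⟩ := g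
  exacts [isForest_revealedAfter hg f, isForest_revealedAfter hg f, hg, hg]

theorem label_next_eq_A_iff {f : Feedback (Msg n)} :
    (g.next f).label = .A ↔ g.label = .D ∧ f ≠ .silence := by
  obtain ⟨_ | _ | _ | _, j, c, R⟩ := g <;> rcases f with _ | _ | _ <;> simp [next, afterD]

theorem label_next_eq_done_iff {f : Feedback (Msg n)} :
    (g.next f).label = .done ↔ g.label = .done ∨ g.label = .D ∧ f = .silence := by
  obtain ⟨_ | _ | _ | _, j, c, R⟩ := g <;> rcases f with _ | _ | _ <;> simp [next, afterD]

end State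

section CommonRun

variable {n : ℕ} {ι : Type} (inp : ι → Input n) (u : ℕ → ι → ℝ)

/-- The feedback in a common state. -/
noncomputable def commonFeedback (x : ι → ℝ) (g : State n) : Feedback (Msg n) :=
  (algorithm n).feedback inp x fun p => g.view (inp p).edge

/-- One step from a common state. -/
noncomputable def commonStep (x : ι → ℝ) (g : State n) : State n :=
  g.next (commonFeedback inp x g)

/-- The common state after `t` steps. -/
noncomputable def commonRun : ℕ → State n :=
  trajectory (commonStep inp) (State.init n) u

theorem step_view (x : ι → ℝ) (g : State n) :
    (algorithm n).step inp x (fun p => g.view (inp p).edge) =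
      fun p => (commonStep inp x g).view (inp p).edge := by
  funext p
  unfold Protocol.step
  split_ifs with h
  · change g.label = .done at h
    simp [commonStep, State.next, h]
  · exact State.next_view (inp p) g _

theorem run_eq_view (t : ℕ) :
    (algorithm n).run inp u t = fun p => (commonRun inp u t).view (inp p).edge := by
  induction t with
  | zero => exact funext fun p => (State.view_init _).symm
  | succ t ih => rw [Protocol.run, ih, step_view, commonRun, trajectory]

theorem feedbackAt_eq (t : ℕ) :
    (algorithm n).feedbackAt inp u t = commonFeedback inp (u t) (commonRun inp u t) := by
  rw [Protocol.feedbackAt, run_eq_view, commonFeedback]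

theorem halted_run_iff (t : ℕ) (p : ι) :
    (algorithm n).halted ((algorithm n).run inp u t p) ↔ (commonRun inp u t).label = .done := by
  rw [run_eq_view]
  rfl

variable {inp u}

theorem exists_feedbackAt_of_mem_revealed {t : ℕ} {e : Sym2 (Fin n)}
    (h : e ∈ (commonRun inp u t).revealed) :
    ∃ s < t, (algorithm n).feedbackAt inp u s = .heard (.edge e) := by
  induction t with
  | zero => exact absurd h (Finset.notMem_empty e)
  | succ t ih =>
    rcases State.mem_revealed_next h with h | h
    · obtain ⟨s, hs, he⟩ := ih h
      exact ⟨s, hs.trans t.lt_succ_self, he⟩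
    · exact ⟨t, t.lt_succ_self, (feedbackAt_eq inp u t).trans h⟩

theorem label_commonRun_succ_of_done {t : ℕ} (h : (commonRun inp u t).label = .done) :
    (commonRun inp u (t + 1)).label = .done :=
  State.label_next_eq_done_iff.2 (.inl h)

end CommonRun

/-! ### Broadcasts in a common state -/

section Broadcasts

variable {n : ℕ} {ι : Type} {inp : ι → Input n} {x : ι → ℝ} {g : State n}

theorem exists_edge_eq_of_commonFeedback_eq {e : Sym2 (Fin n)}
    (h : commonFeedback inp x g = .heard (.edge e)) : ∃ p, (inp p).edge = e := by
  rw [commonFeedback, Protocol.feedback] at h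
  obtain ⟨p, -, hp, -⟩ := channel_eq_heard_iff.1 h
  refine ⟨p, ?_⟩
  obtain ⟨_ | _ | _ | _, j, c, R⟩ := g <;> simp_all [algorithm, msg, State.view]

theorem commonFeedback_of_label_C (hx : ∀ p, x p ∈ Set.Ico (0 : ℝ) 1) (hl : g.label = .C) :
    commonFeedback inp x g =
      channel (fun p => (inp p).id = g.counter) fun p => .edge (inp p).edge := by
  unfold commonFeedback Protocol.feedback
  refine congrArg₂ channel (funext fun p => propext ?_) (funext fun p => ?_)
  · simp only [Protocol.Broadcasts, algorithm, prob, State.view, hl]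
    split_ifs with h <;> simp [h, (hx p).1.not_gt, (hx p).2]
  · simp only [algorithm, msg, State.view, hl]

variable [Fintype ι]

open Classical in
/-- The stations whose edges are waiting. -/
noncomputable def waitingStations (inp : ι → Input n) (R : Finset (Sym2 (Fin n))) : Finset ι :=
  {p | IsWaiting R (inp p).edge}

theorem mem_waitingStations {R : Finset (Sym2 (Fin n))} {p : ι} :
    p ∈ waitingStations inp R ↔ IsWaiting R (inp p).edge := by
  simp [waitingStations]

theorem waitingStations_anti {R S : Finset (Sym2 (Fin n))} (h : R ⊆ S) :
    waitingStations inp S ⊆ waitingStations inp R := fun _ hp =>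
  mem_waitingStations.2 ((mem_waitingStations.1 hp).anti h)

theorem commonFeedback_of_label_A (hx : ∀ p, x p ∈ Set.Ico (0 : ℝ) 1) (hl : g.label = .A) :
    commonFeedback inp x g =
      channel (fun p => p ∈ waitingStations inp g.revealed ∧ x p ∈ Set.Iio ((3 : ℝ) ^ g.exp)⁻¹)
        fun p => .edge (inp p).edge := by
  unfold commonFeedback Protocol.feedback
  refine congrArg₂ channel (funext fun p => propext ?_) (funext fun p => ?_)
  · simp only [Protocol.Broadcasts, algorithm, prob, State.view, hl, mem_waitingStations,
      ← statusOf_eq_waiting_iff]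
    split_ifs with h <;> simp [h, (hx p).1.not_gt]
  · simp only [algorithm, msg, State.view, hl]

theorem commonFeedback_of_label_D (hx : ∀ p, x p ∈ Set.Ico (0 : ℝ) 1) (hl : g.label = .D) :
    commonFeedback inp x g =
      channel (fun p => p ∈ waitingStations inp g.revealed) fun _ => .dummy := by
  unfold commonFeedback Protocol.feedback
  refine congrArg₂ channel (funext fun p => propext ?_) (funext fun p => ?_)
  · simp only [Protocol.Broadcasts, algorithm, prob, State.view, hl, mem_waitingStations,
      ← statusOf_eq_waiting_iff]
    split_ifs with h <;> simp [h, (hx p).1.not_gt, (hx p).2]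
  · simp only [algorithm, msg, State.view, hl]

theorem commonFeedback_eq_silence_iff_of_label_D (hx : ∀ p, x p ∈ Set.Ico (0 : ℝ) 1)
    (hl : g.label = .D) :
    commonFeedback inp x g = .silence ↔ waitingStations inp g.revealed = ∅ := by
  rw [commonFeedback_of_label_D hx hl, channel_eq_silence_iff, Finset.eq_empty_iff_forall_notMem]

end Broadcasts

/-! ### Invariants and termination -/

/-- The number of steps that remain until the next round starts. -/
def Label.stepsToRound : Label → ℕ
  | .A => 0
  | .C => 2
  | .D => 1
  | .done => 0

/-- The number of steps C made so far; so many stations have been called in these steps. -/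
def State.called {n : ℕ} (g : State n) : ℕ :=
  match g.label with
  | .C => g.counter - 1
  | _ => g.counter

theorem State.lt_called_next {n : ℕ} {g : State n} {f : Feedback (Msg n)} {k : ℕ}
    (h : k < (g.next f).called) : k < g.called ∨ g.label = .C ∧ k + 1 = g.counter := by
  obtain ⟨_ | _ | _ | _, j, c, R⟩ := g <;> rcases f with _ | _ | _ <;>
    simp [called, next, afterD] at h ⊢ <;> omega

theorem State.add_stepsToRound_next {n t : ℕ} {g : State n}
    (h : g.label = .done ∨ t + g.label.stepsToRound = 3 * g.counter) (f : Feedback (Msg n)) :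
    (g.next f).label = .done ∨
      t + 1 + (g.next f).label.stepsToRound = 3 * (g.next f).counter := by
  obtain ⟨_ | _ | _ | _, j, c, R⟩ := g <;> rcases f with _ | _ | _ <;>
    simp [next, Label.stepsToRound, afterD] at h ⊢ <;> omega

theorem label_eq_done_or_add_stepsToRound_eq {n : ℕ} {ι : Type} (inp : ι → Input n)
    (u : ℕ → ι → ℝ) (t : ℕ) : (commonRun inp u t).label = .done ∨
      t + (commonRun inp u t).label.stepsToRound = 3 * (commonRun inp u t).counter := by
  induction t with
  | zero => exact .inr rfl
  | succ t ih => exact State.add_stepsToRound_next ih _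

section Invariant

variable {n m : ℕ} {G : SimpleGraph (Fin n)} {edge : Fin m ≃ G.edgeSet} {x : Fin m → ℝ}
  {g : State n} {u : ℕ → Fin m → ℝ}

/-- What is true of the common state throughout the execution. -/
structure Invariant (edge : Fin m ≃ G.edgeSet) (g : State n) : Prop where
  subset : (g.revealed : Set (Sym2 (Fin n))) ⊆ G.edgeSet
  isForest : IsForest g.revealed
  nonempty_of_label_A : Nonempty (Fin m) → g.label = .A →
    (waitingStations (input edge) g.revealed).Nonempty
  eq_empty_of_label_done : g.label = .done → waitingStations (input edge) g.revealed = ∅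
  notMem_of_lt_called : ∀ p : Fin m, p < g.called → p ∉ waitingStations (input edge) g.revealed

theorem invariant_init : Invariant edge (State.init n) where
  subset := by simp [State.init]
  isForest := isForest_empty
  nonempty_of_label_A := fun ⟨p⟩ _ =>
    ⟨p, mem_waitingStations.2 (by simp [State.init, IsWaiting, isForest_singleton])⟩
  eq_empty_of_label_done h := by simp [State.init] at h
  notMem_of_lt_called p h := absurd h p.1.not_lt_zero

theorem subset_edgeSet_commonStep (h : (g.revealed : Set (Sym2 (Fin n))) ⊆ G.edgeSet) :
    ((commonStep (input edge) x g).revealed : Set (Sym2 (Fin n))) ⊆ G.edgeSet := by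
  intro e he
  rcases State.mem_revealed_next he with he | he
  · exact h he
  · obtain ⟨p, rfl⟩ := exists_edge_eq_of_commonFeedback_eq he
    exact (edge p).2

theorem commonFeedback_eq_heard_of_label_C (hx : ∀ p, x p ∈ Set.Ico (0 : ℝ) 1)
    (hl : g.label = .C) {p : Fin m} (hp : (p : ℕ) + 1 = g.counter) :
    commonFeedback (input edge) x g = .heard (.edge (edge p)) := by
  rw [commonFeedback_of_label_C hx hl]
  exact channel_eq_heard_of_unique hp fun q hq => Fin.ext (Nat.succ.inj (hq.trans hp.symm))

theorem State.revealed_next_of_label_D {f : Feedback (Msg n)} (hl : g.label = .D) :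
    (g.next f).revealed = g.revealed := by
  simp [State.next, hl]

theorem Invariant.step (hg : Invariant edge g) (hx : ∀ p, x p ∈ Set.Ico (0 : ℝ) 1) :
    Invariant edge (commonStep (input edge) x g) where
  subset := subset_edgeSet_commonStep hg.subset
  isForest := State.isForest_revealed_next hg.isForest _
  nonempty_of_label_A _ h := by
    obtain ⟨hl, hf⟩ := State.label_next_eq_A_iff.1 h
    rw [Ne, commonFeedback_eq_silence_iff_of_label_D hx hl] at hf
    rw [commonStep, State.revealed_next_of_label_D hl]
    exact Finset.nonempty_iff_ne_empty.2 hf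
  eq_empty_of_label_done h := by
    rcases State.label_next_eq_done_iff.1 h with hl | ⟨hl, hf⟩
    · simpa [commonStep, State.next, hl] using hg.eq_empty_of_label_done hl
    · rw [commonStep, State.revealed_next_of_label_D hl]
      exact (commonFeedback_eq_silence_iff_of_label_D hx hl).1 hf
  notMem_of_lt_called p h hp := by
    rcases State.lt_called_next h with h | ⟨hl, hc⟩
    · exact hg.notMem_of_lt_called p h
        (waitingStations_anti (State.revealed_subset_next _) hp)
    · rw [mem_waitingStations, commonStep, commonFeedback_eq_heard_of_label_C hx hl hc,
        State.next, hl] at hp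
      exact not_isWaiting_addRevealed hp

theorem invariant_commonRun (hu : ∀ t p, u t p ∈ Set.Ico (0 : ℝ) 1) (t : ℕ) :
    Invariant edge (commonRun (input edge) u t) :=
  trajectory_induction invariant_init (fun t _ hg => hg.step (hu t)) t

theorem Invariant.isSpanningForest (hg : Invariant edge g)
    (h : waitingStations (input edge) g.revealed = ∅) : IsSpanningForest G g.revealed := by
  refine ⟨hg.subset, hg.isForest, fun e he heR hf => ?_⟩
  refine Finset.eq_empty_iff_forall_notMem.1 h (edge.symm ⟨e, he⟩) (mem_waitingStations.2 ?_)
  simpa [input] using ⟨heR, hf⟩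

theorem label_commonRun_three_mul (p : Fin m) (hu : ∀ t p, u t p ∈ Set.Ico (0 : ℝ) 1) :
    (commonRun (input edge) u (3 * m)).label = .done := by
  by_contra hdone
  have hg := invariant_commonRun (edge := edge) hu (3 * m)
  have ht := (label_eq_done_or_add_stepsToRound_eq (input edge) u (3 * m)).resolve_left hdone
  rcases hl : (commonRun (input edge) u (3 * m)).label with _ | _ | _ | _ <;>
    simp only [hl, Label.stepsToRound] at ht
  · obtain ⟨q, hq⟩ := hg.nonempty_of_label_A ⟨p⟩ hl
    refine hg.notMem_of_lt_called q ?_ hq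
    simp only [State.called, hl]
    omega
  · omega
  · omega
  · exact hdone hl

end Invariant

end RandSimple

/-! ### Running time -/

theorem iInf_natCast_eq_find {p : ℕ → Prop} [DecidablePred p] (h : ∃ k, p k) :
    ⨅ (k : ℕ) (_ : p k), (k : ℕ∞) = (Nat.find h : ℕ∞) :=
  le_antisymm (iInf₂_le _ (Nat.find_spec h))
    (le_iInf₂ fun _ hk => Nat.cast_le.2 (Nat.find_min' h hk))

open Classical in
theorem iInf_natCast_eq_tsum {p : ℕ → Prop} (hp : ∀ t, p t → p (t + 1)) :
    ((⨅ (k : ℕ) (_ : p k), (k : ℕ∞) : ℕ∞) : ℝ≥0∞) = ∑' t, if p t then 0 else 1 := by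
  by_cases h : ∃ k, p k
  · rw [iInf_natCast_eq_find h, tsum_eq_sum (s := Finset.range (Nat.find h))]
    · rw [Finset.sum_congr rfl fun t ht => if_neg (Nat.find_min h (Finset.mem_range.1 ht))]
      simp
    · intro t ht
      rw [Finset.mem_range, not_lt] at ht
      exact if_pos (Nat.le_induction (Nat.find_spec h) (fun t _ => hp t) t ht)
  · rw [not_exists] at h
    simp [h]

theorem Protocol.time_eq_zero_of_isEmpty {ι Inp St Msg : Type} [IsEmpty ι]
    (A : Protocol Inp St Msg) (inp : ι → Inp) (u : ℕ → ι → ℝ) : A.time inp u = 0 :=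
  le_antisymm (iInf₂_le 0 isEmptyElim) bot_le

namespace RandSimple

section Execution

variable {n m : ℕ} {G : SimpleGraph (Fin n)} {edge : Fin m ≃ G.edgeSet} {u : ℕ → Fin m → ℝ}

theorem isSpanningForest_of_halted (hu : ∀ t p, u t p ∈ Set.Ico (0 : ℝ) 1) {t : ℕ}
    (h : ∀ p, (algorithm n).halted ((algorithm n).run (input edge) u t p)) :
    IsSpanningForest G (commonRun (input edge) u t).revealed := by
  have hg := invariant_commonRun (edge := edge) hu t
  refine hg.isSpanningForest (Finset.eq_empty_iff_forall_notMem.2 fun p => ?_)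
  rw [hg.eq_empty_of_label_done ((halted_run_iff _ _ t p).1 (h p))]
  exact Finset.notMem_empty p

theorem exists_time_eq (hu : ∀ t p, u t p ∈ Set.Ico (0 : ℝ) 1) :
    ∃ k : ℕ, (algorithm n).time (input edge) u = (k : ℕ∞) ∧ k ≤ 3 * m ∧
      ∃ T : Finset (Sym2 (Fin n)), IsSpanningForest G T ∧
        (∀ e ∈ T, ∃ t < k, (algorithm n).feedbackAt (input edge) u t = .heard (.edge e)) ∧
        ∀ p : Fin m, ((algorithm n).run (input edge) u k p).revealed = T ∧
          (((algorithm n).run (input edge) u k p).status = .revealed ↔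
            (edge p : Sym2 (Fin n)) ∈ T) := by
  classical
  have halted_three_mul (p : Fin m) :
      (algorithm n).halted ((algorithm n).run (input edge) u (3 * m) p) :=
    (halted_run_iff _ _ _ p).2 (label_commonRun_three_mul p hu)
  have hex : ∃ k, ∀ p, (algorithm n).halted ((algorithm n).run (input edge) u k p) :=
    ⟨_, halted_three_mul⟩
  refine ⟨Nat.find hex, iInf_natCast_eq_find hex, Nat.find_min' hex halted_three_mul,
    (commonRun (input edge) u (Nat.find hex)).revealed,
    isSpanningForest_of_halted hu (Nat.find_spec hex),
    fun e he => exists_feedbackAt_of_mem_revealed he, fun p => ?_⟩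
  rw [run_eq_view]
  exact ⟨rfl, statusOf_eq_revealed_iff⟩

theorem card_le_time (hu : ∀ t p, u t p ∈ Set.Ico (0 : ℝ) 1) {T : Finset (Sym2 (Fin n))}
    (hT : IsSpanningForest G T) : (T.card : ℕ∞) ≤ (algorithm n).time (input edge) u := by
  obtain ⟨k, hk, -, S, hS, hheard, -⟩ := exists_time_eq (edge := edge) hu
  choose! t t_lt heard_at using hheard
  rw [hk, Nat.cast_le, hT.card_eq hS, ← Finset.card_range k]
  refine Finset.card_le_card_of_injOn t (fun e he => by simpa using t_lt e he) ?_
  intro e he e' he' h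
  have heard_eq : Feedback.heard (Msg.edge e) = .heard (.edge e') :=
    (heard_at e he).symm.trans (h ▸ heard_at e' he')
  simpa using heard_eq

end Execution

/-- The cost of a step in a common state. -/
def State.stepCost {n : ℕ} (g : State n) : ℝ≥0∞ :=
  match g.label with
  | .done => 0
  | _ => 1

theorem time_eq_tsum {n : ℕ} {ι : Type} [Nonempty ι] (inp : ι → Input n) (u : ℕ → ι → ℝ) :
    ((algorithm n).time inp u : ℝ≥0∞) = ∑' t, (commonRun inp u t).stepCost := by
  classical
  simp only [Protocol.time, halted_run_iff, forall_const]
  rw [iInf_natCast_eq_tsum (p := fun t => (commonRun inp u t).label = .done)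
    fun t => label_commonRun_succ_of_done]
  congr 1 with t
  unfold State.stepCost
  rcases (commonRun inp u t).label with _ | _ | _ | _ <;> simp

section Measurability

variable {n : ℕ} {ι : Type} (inp : ι → Input n)

instance : Countable Label :=
  Function.Injective.countable (f := Label.ctorIdx) (by
    rintro (_ | _ | _ | _) (_ | _ | _ | _) <;> simp [Label.ctorIdx])

instance : Countable (State n) :=
  Function.Injective.countable (f := fun g => (g.label, g.exp, g.counter, g.revealed)) (by
    rintro ⟨⟩ ⟨⟩ h
    simpa using h)

instance : MeasurableSpace (State n) := ⊤

instance : DiscreteMeasurableSpace (State n) := ⟨fun _ => trivial⟩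

theorem measurable_commonStep [Finite ι] : Measurable (Function.uncurry (commonStep inp)) := by
  refine measurable_from_prod_countable_left fun g => ?_
  let stepAfter (b : ι → Prop) : State n :=
    g.next (channel (fun p => ¬ g.label = .done ∧ b p) fun p => msg (inp p) (g.view (inp p).edge))
  have measurable_success : Measurable fun (x : ι → ℝ) p =>
      x p < prob (inp p) (g.view (inp p).edge) :=
    measurable_pi_lambda _ fun p =>
      measurableSet_setOfPred.1 (measurableSet_lt (measurable_pi_apply p) measurable_const)
  exact (measurable_of_countable stepAfter).comp measurable_success

theorem measurable_time [Finite ι] {Ω : Type*} [MeasurableSpace Ω] {U : ℕ → ι → Ω → ℝ}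
    (hU : ∀ t p, Measurable (U t p)) :
    Measurable fun ω => ((algorithm n).time inp (fun t p => U t p ω) : ℝ≥0∞) := by
  rcases isEmpty_or_nonempty ι with _ | _
  · simp only [Protocol.time_eq_zero_of_isEmpty]
    exact measurable_const
  · simp only [time_eq_tsum]
    exact Measurable.tsum fun t => (measurable_of_countable State.stepCost).comp
      (measurable_trajectory (State.init n) (measurable_commonStep inp)
        fun s _ => measurable_pi_lambda _ (hU s))

end Measurability

end RandSimple

/-! ### The drift of the execution -/

section ChannelTrials

variable {ι M α : Type} {W : Finset ι} {A : Set α} {x : ι → α} {msg : ι → M}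

theorem channel_of_mem_noSuccess (h : x ∈ noSuccess W A) :
    channel (fun p => p ∈ W ∧ x p ∈ A) msg = .silence :=
  channel_eq_silence_iff.2 fun p hp => h p hp.1 hp.2

theorem exists_channel_eq_heard_of_mem_oneSuccess (h : x ∈ oneSuccess W A) :
    ∃ p ∈ W, channel (fun p => p ∈ W ∧ x p ∈ A) msg = .heard (msg p) := by
  obtain ⟨p, hp, hxp, hx⟩ := Set.mem_iUnion₂.1 h
  exact ⟨p, hp, channel_eq_heard_of_unique ⟨hp, hxp⟩
    fun q hq => of_not_not fun hne => hx q hq.1 hne hq.2⟩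

theorem channel_of_notMem_noSuccess_of_notMem_oneSuccess (h₀ : x ∉ noSuccess W A)
    (h₁ : x ∉ oneSuccess W A) : channel (fun p => p ∈ W ∧ x p ∈ A) msg = .noise := by
  rcases h : channel (fun p => p ∈ W ∧ x p ∈ A) msg with _ | y | _
  · exact absurd (fun p hp hxp => channel_eq_silence_iff.1 h p ⟨hp, hxp⟩) h₀
  · obtain ⟨p, hp, -, hu⟩ := channel_eq_heard_iff.1 h
    have hx : x ∈ onlySuccess W A p := ⟨hp.2, fun q hq hne hxq => hne (hu q ⟨hq, hxq⟩)⟩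
    exact absurd (Set.mem_iUnion₂.2 ⟨p, hp.1, hx⟩) h₁
  · rfl

end ChannelTrials

namespace RandSimple

section Drift

variable {n : ℕ} {ι : Type} [Fintype ι] {inp : ι → Input n} {x : ι → ℝ} {g : State n} {r : ℕ}

/-- The potential of the rounds to come when the edges in `R` are revealed and `a = 3 ^ j`; here
`r` is the size of a spanning forest. -/
noncomputable def roundPotential (inp : ι → Input n) (r : ℕ) (R : Finset (Sym2 (Fin n)))
    (j : ℕ) : ℕ :=
  15 * (r - R.card) + backoffPotential (waitingStations inp R).card j

/-- A bound for the mean number of steps to come; it exceeds three steps per unit of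
`roundPotential` by the number of steps to the next round. -/
noncomputable def potential (inp : ι → Input n) (r : ℕ) (g : State n) : ℕ :=
  match g.label with
  | .done => 0
  | l => 3 * roundPotential inp r g.revealed g.exp + l.stepsToRound

theorem roundPotential_anti {R S : Finset (Sym2 (Fin n))} (h : R ⊆ S) (j : ℕ) :
    roundPotential inp r S j ≤ roundPotential inp r R j := by
  have := Finset.card_le_card h
  have := backoffPotential_mono (Finset.card_le_card (waitingStations_anti (inp := inp) h)) j
  unfold roundPotential
  omega

theorem roundPotential_insert_add_le {R : Finset (Sym2 (Fin n))} {e : Sym2 (Fin n)} (he : e ∉ R)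
    (hr : R.card < r) (j : ℕ) :
    roundPotential inp r (insert e R) j + 15 ≤ roundPotential inp r R j := by
  have := backoffPotential_mono (Finset.card_le_card
    (waitingStations_anti (inp := inp) (Finset.subset_insert e R))) j
  rw [roundPotential, roundPotential, Finset.card_insert_of_notMem he]
  omega

theorem potential_commonStep_of_label_A (hl : g.label = .A) :
    potential inp r (commonStep inp x g) = 3 * roundPotential inp r
      (revealedAfter g.revealed (commonFeedback inp x g))
      (expAfter g.exp (commonFeedback inp x g)) + 2 := by
  simp only [potential, commonStep, State.next, hl, Label.stepsToRound]

theorem potential_commonStep_add_le_of_mem_oneSuccess (hx : ∀ p, x p ∈ Set.Ico (0 : ℝ) 1)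
    (hl : g.label = .A) (hr : g.revealed.card < r)
    (h : x ∈ oneSuccess (waitingStations inp g.revealed) (Set.Iio ((3 : ℝ) ^ g.exp)⁻¹)) :
    potential inp r (commonStep inp x g) + 45 ≤
      3 * roundPotential inp r g.revealed g.exp + 2 := by
  obtain ⟨p, hp, hf⟩ := exists_channel_eq_heard_of_mem_oneSuccess
    (msg := fun p => Msg.edge (inp p).edge) h
  have hwaiting := mem_waitingStations.1 hp
  have := roundPotential_insert_add_le (inp := inp) hwaiting.1 hr g.exp
  rw [potential_commonStep_of_label_A hl, commonFeedback_of_label_A hx hl, hf, revealedAfter,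
    expAfter, addRevealed, if_pos hwaiting.2]
  omega

theorem drift_of_label_A (hl : g.label = .A) (hr : g.revealed.card < r)
    (hw : (waitingStations inp g.revealed).Nonempty) :
    ∫⁻ x, (potential inp r (commonStep inp x g) : ℝ≥0∞) ∂trials ι + 1 ≤ potential inp r g := by
  have hq₀ : 0 ≤ ((3 : ℝ) ^ g.exp)⁻¹ := by positivity
  have hq : ((3 : ℝ) ^ g.exp)⁻¹ ≤ 1 := inv_le_one_of_one_le₀ (one_le_pow₀ (by norm_num))
  have h45 : 45 ≤ 3 * roundPotential inp r g.revealed g.exp := by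
    unfold roundPotential
    omega
  have hpotential : potential inp r g = 3 * roundPotential inp r g.revealed g.exp := by
    simp [potential, hl, Label.stepsToRound]
  have hmean := lintegral_natCast_trials_le (waitingStations inp g.revealed) hq₀ hq
    (f := fun x => potential inp r (commonStep inp x g))
    (a := 3 * roundPotential inp r g.revealed (g.exp - 1) + 2)
    (b := 3 * roundPotential inp r g.revealed g.exp + 2 - 45)
    (c := 3 * roundPotential inp r g.revealed (g.exp + 1) + 2) ?_ ?_ ?_
  · have hbackoff := backoff_drift hw.card_pos (rfl : ((3 : ℝ) ^ g.exp)⁻¹ = _)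
    rw [hpotential,
      ← Nat.sub_add_cancel (show 1 ≤ 3 * roundPotential inp r g.revealed g.exp by lia),
      Nat.cast_add, Nat.cast_one]
    gcongr
    refine hmean.trans (ENNReal.ofReal_le_of_le_toReal ?_)
    rw [ENNReal.toReal_natCast, Nat.cast_sub (by lia), Nat.cast_sub (by lia)]
    unfold roundPotential
    push_cast
    linarith
  · filter_upwards [ae_mem_Ico_trials] with x hx h
    rw [potential_commonStep_of_label_A hl, commonFeedback_of_label_A hx hl,
      channel_of_mem_noSuccess h, revealedAfter, expAfter]
  · filter_upwards [ae_mem_Ico_trials] with x hx h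
    exact Nat.le_sub_of_add_le (potential_commonStep_add_le_of_mem_oneSuccess hx hl hr h)
  · filter_upwards [ae_mem_Ico_trials] with x hx h₀ h₁
    rw [potential_commonStep_of_label_A hl, commonFeedback_of_label_A hx hl,
      channel_of_notMem_noSuccess_of_notMem_oneSuccess h₀ h₁, revealedAfter, expAfter]

theorem drift_of_label_C (hl : g.label = .C) :
    ∫⁻ x, (potential inp r (commonStep inp x g) : ℝ≥0∞) ∂trials ι + 1 ≤ potential inp r g := by
  refine lintegral_natCast_add_one_le fun x => ?_
  have := roundPotential_anti (inp := inp) (r := r)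
    (subset_revealedAfter (R := g.revealed) (commonFeedback inp x g)) g.exp
  simp only [potential, commonStep, State.next, hl, Label.stepsToRound]
  omega

theorem drift_of_label_D (hl : g.label = .D) :
    ∫⁻ x, (potential inp r (commonStep inp x g) : ℝ≥0∞) ∂trials ι + 1 ≤ potential inp r g := by
  refine lintegral_natCast_add_one_le fun x => ?_
  simp only [potential, commonStep, State.next, hl]
  rcases commonFeedback inp x g with _ | _ | _ <;> simp [afterD, Label.stepsToRound]

end Drift

section ExpectedTime

variable {n m : ℕ} {G : SimpleGraph (Fin n)} {edge : Fin m ≃ G.edgeSet} {g : State n}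
  {T : Finset (Sym2 (Fin n))}

theorem Invariant.card_revealed_lt (hg : Invariant edge g) (hT : IsSpanningForest G T)
    (hw : (waitingStations (input edge) g.revealed).Nonempty) : g.revealed.card < T.card := by
  obtain ⟨p, hp⟩ := hw
  obtain ⟨hnotMem, hforest⟩ := mem_waitingStations.1 hp
  rw [← Nat.succ_le_iff, Nat.succ_eq_add_one, ← Finset.card_insert_of_notMem hnotMem]
  refine hforest.card_le_of_isSpanningForest ?_ hT
  rw [Finset.coe_insert, Set.insert_subset_iff]
  exact ⟨(edge p).2, hg.subset⟩

theorem Invariant.drift [Nonempty (Fin m)] (hg : Invariant edge g) (hT : IsSpanningForest G T) :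
    ∫⁻ x, (potential (input edge) T.card (commonStep (input edge) x g) : ℝ≥0∞) ∂trials (Fin m) +
      g.stepCost ≤ potential (input edge) T.card g := by
  rcases hl : g.label with _ | _ | _ | _ <;> simp only [State.stepCost, hl]
  · have hw := hg.nonempty_of_label_A inferInstance hl
    exact drift_of_label_A hl (hg.card_revealed_lt hT hw) hw
  · exact drift_of_label_C hl
  · exact drift_of_label_D hl
  · simp [potential, commonStep, State.next, hl]

theorem potential_init_le (hT : IsSpanningForest G T) :
    potential (input edge) T.card (State.init n) ≤ 57 * T.card := by
  have hm : m ≤ T.card * (2 * T.card + 1) := by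
    simpa [← Nat.card_congr edge] using hT.card_edgeSet_le
  have bernoulli : 2 * T.card + 1 ≤ 3 ^ T.card := by
    have := one_add_mul_le_pow (show (-2 : ℤ) ≤ 2 by norm_num) T.card
    norm_num at this
    zify
    linarith
  have hlog : Nat.clog 3 (2 * m) ≤ 2 * T.card := by
    rw [Nat.clog_le_iff_le_pow (by norm_num), mul_comm 2 T.card, pow_mul]
    nlinarith
  have hbackoff : backoffPotential (waitingStations (input edge) ∅).card 0 ≤ 4 * T.card := by
    refine (backoffPotential_mono (w := m)
      (by simpa using Finset.card_le_univ (waitingStations (input edge) ∅)) 0).trans ?_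
    unfold backoffPotential
    omega
  simp only [potential, State.init, roundPotential, Label.stepsToRound, Finset.card_empty]
  omega

variable {Ω : Type*} [MeasurableSpace Ω] {P : Measure Ω} {U : ℕ → Fin m → Ω → ℝ}

theorem map_eq_trials (hU : ∀ t p, Measurable (U t p))
    (hunif : ∀ t p, pdf.IsUniform (U t p) (Set.Ico (0 : ℝ) 1) P volume)
    (hind : iIndepFun (fun q : ℕ × Fin m => U q.1 q.2) P) (t : ℕ) :
    P.map (fun ω p => U t p ω) = trials (Fin m) := by
  rw [(hind.precomp (Prod.mk_right_injective t)).map_fun_eq_infinitePi_map (hU t), trials]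
  exact congrArg Measure.infinitePi (funext fun p => hunif t p)

theorem ae_forall_mem_Ico (hU : ∀ t p, Measurable (U t p))
    (hunif : ∀ t p, pdf.IsUniform (U t p) (Set.Ico (0 : ℝ) 1) P volume) :
    ∀ᵐ ω ∂P, ∀ t p, U t p ω ∈ Set.Ico (0 : ℝ) 1 := by
  refine ae_all_iff.2 fun t => ae_all_iff.2 fun p => ae_of_ae_map (hU t p).aemeasurable ?_
  rw [hunif t p]
  exact ae_mem_Ico_uniformUnit

theorem lintegral_time_le [IsProbabilityMeasure P] (hU : ∀ t p, Measurable (U t p))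
    (hunif : ∀ t p, pdf.IsUniform (U t p) (Set.Ico (0 : ℝ) 1) P volume)
    (hind : iIndepFun (fun q : ℕ × Fin m => U q.1 q.2) P) (hT : IsSpanningForest G T) :
    ∫⁻ ω, ((algorithm n).time (input edge) (fun t p => U t p ω) : ℝ≥0∞) ∂P ≤
      (57 : ℕ) * T.card := by
  rcases isEmpty_or_nonempty (Fin m) with _ | _
  · simp [Protocol.time_eq_zero_of_isEmpty]
  simp only [time_eq_tsum]
  calc _ ≤ (potential (input edge) T.card (State.init n) : ℝ≥0∞) :=
        lintegral_tsum_cost_le (State.init n) (F := commonStep (input edge))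
          (U := fun t ω p => U t p ω) (I := Invariant edge)
          (Ψ := fun g => potential (input edge) T.card g)
          (measurable_commonStep _) (fun t => measurable_pi_lambda _ (hU t))
          (iIndepFun_curry hU hind) (map_eq_trials hU hunif hind)
          (by filter_upwards [ae_forall_mem_Ico hU hunif] with ω hω using invariant_commonRun hω)
          (measurable_of_countable _) (measurable_of_countable _) fun g hg => hg.drift hT
    _ ≤ (57 : ℕ) * T.card := by exact_mod_cast potential_init_le hT

theorem card_le_lintegral_time [IsProbabilityMeasure P] (hU : ∀ t p, Measurable (U t p))
    (hunif : ∀ t p, pdf.IsUniform (U t p) (Set.Ico (0 : ℝ) 1) P volume)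
    (hT : IsSpanningForest G T) :
    (T.card : ℝ≥0∞) ≤ ∫⁻ ω, ((algorithm n).time (input edge) (fun t p => U t p ω) : ℝ≥0∞) ∂P := by
  calc (T.card : ℝ≥0∞) = ∫⁻ _, (T.card : ℝ≥0∞) ∂P := by simp
    _ ≤ _ := lintegral_mono_ae <| by
        filter_upwards [ae_forall_mem_Ico hU hunif] with ω hω
        exact_mod_cast ENat.toENNReal_le.2 (card_le_time hω hT)

end ExpectedTime

end RandSimple

theorem mainTheorem2 :
    ∃ C : ℕ, ∀ (n m : ℕ) (G : SimpleGraph (Fin n)) (edge : Fin m ≃ G.edgeSet),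
      -- every execution stops within `C * m` steps with a spanning forest, heard on the channel
      (∀ u : ℕ → Fin m → ℝ, (∀ t p, u t p ∈ Set.Ico (0 : ℝ) 1) →
        ∃ k : ℕ, (RandSimple.algorithm n).time (RandSimple.input edge) u = (k : ℕ∞) ∧
          k ≤ C * m ∧
          ∃ T : Finset (Sym2 (Fin n)), IsSpanningForest G T ∧
            (∀ e ∈ T, ∃ t < k,
              (RandSimple.algorithm n).feedbackAt (RandSimple.input edge) u t =
                Feedback.heard (RandSimple.Msg.edge e)) ∧
            ∀ p : Fin m,
              ((RandSimple.algorithm n).run (RandSimple.input edge) u k p).revealed = T ∧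
              (((RandSimple.algorithm n).run (RandSimple.input edge) u k p).status =
                RandSimple.Status.revealed ↔ (edge p : Sym2 (Fin n)) ∈ T)) ∧
      -- the expected time, over independent random trials, is proportional to `|T|`
      (∀ (Ω : Type*) [MeasurableSpace Ω] (P : Measure Ω) [IsProbabilityMeasure P]
        (U : ℕ → Fin m → Ω → ℝ),
        (∀ t p, Measurable (U t p)) →
        (∀ t p, pdf.IsUniform (U t p) (Set.Ico (0 : ℝ) 1) P volume) →
        iIndepFun (fun q : ℕ × Fin m => U q.1 q.2) P →
        Measurable (fun ω =>
          (((RandSimple.algorithm n).time (RandSimple.input edge) (fun t p => U t p ω) : ℕ∞) :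
            ℝ≥0∞)) ∧
        ∀ T : Finset (Sym2 (Fin n)), IsSpanningForest G T →
          (T.card : ℝ≥0∞) ≤
            ∫⁻ ω, (((RandSimple.algorithm n).time (RandSimple.input edge)
              (fun t p => U t p ω) : ℕ∞) : ℝ≥0∞) ∂P ∧
          ∫⁻ ω, (((RandSimple.algorithm n).time (RandSimple.input edge)
              (fun t p => U t p ω) : ℕ∞) : ℝ≥0∞) ∂P ≤ (C : ℝ≥0∞) * (T.card : ℝ≥0∞)) := by
  refine ⟨57, fun n m G edge => ⟨fun u hu => ?_, fun Ω _ P _ U hU hunif hind =>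
    ⟨RandSimple.measurable_time _ hU, fun T hT =>
      ⟨RandSimple.card_le_lintegral_time hU hunif hT,
        RandSimple.lintegral_time_le hU hunif hind hT⟩⟩⟩⟩
  obtain ⟨k, time_eq, k_le, houtput⟩ := RandSimple.exists_time_eq (edge := edge) hu
  exact ⟨k, time_eq, by omega, houtput⟩
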